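/- For a positive integer $n$ let $\Omega_n=\{0,1,-1,\dots,n,-n\}$ and let $\mathfrak B_n$ be the hyperoctahedral group of all signed permutations of length $n$, that is, of all bijections $\pi:\Omega_n\to\Omega_n$ with $\pi(-a)=-\pi(a)$ for every $a\in\Omega_n$; write $\pi_i=\pi(i)$ for $0\le i\le n$, so that $\pi_0=0$. Let $<_r$ be the total order $$-1<_r-2<_r-3<_r\cdots<_r0<_r1<_r2<_r3<_r\cdots$$ on $\mathbb Z$, and let $\mathrm{des}_B(\pi)=\#\{i\in\{0,1,\dots,n-1\} : \pi_i>_r\pi_{i+1}\}$. For $k\in\mathbb Z$ let $I^{\underline B}_{n,k}$ be the number of $\pi\in\mathfrak B_n$ with $\pi^{-1}=\pi$ and $\mathrm{des}_B(\pi)=k$. Theorem. For all integers $n\ge 3$ and $k\ge 0$, $$\begin{aligned} n I^{\underline B}_{n,k}={}&(2k+1)\,I^{\underline B}_{n-1,k}+(2n-2k+1)\,I^{\underline B}_{n-1,k-1}+\bigl(n-1+2k(k+1)\bigr)I^{\underline B}_{n-2,k}\\ &+\bigl(2(n-1)+4(n-k-1)(k-1)\bigr)I^{\underline B}_{n-2,k-1}\\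 &+\bigl((2n-3)(n-1)+2(k-2)(k-2n+1)\bigr)I^{\underline B}_{n-2,k-2}, \end{aligned}$$ where $I^{\underline B}_{1,0}=1$, $I^{\underline B}_{1,1}=1$, $I^{\underline B}_{2,0}=1$, $I^{\underline B}_{2,1}=4$, $I^{\underline B}_{2,2}=1$, and $I^{\underline B}_{n,k}=0$ for all $n\ge1$ and $k<0$. -/

import Mathlib

/-- The set `Ω_n = {0, 1, -1, …, n, -n}`. -/
abbrev SignedSet (n : ℕ) : Type := {a : ℤ // -(n : ℤ) ≤ a ∧ a ≤ n}

instance SignedSet.instNeg (n : ℕ) : Neg (SignedSet n) :=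
  ⟨fun a => ⟨-a.1, by have := a.2; omega⟩⟩

/-- The element `i` of `Ω_n`, for a natural number `i ≤ n`. -/
def SignedSet.ofNat {n : ℕ} (i : ℕ) (hi : i ≤ n) : SignedSet n :=
  ⟨(i : ℤ), by omega⟩

/-- The hyperoctahedral group: the bijections `π : Ω_n → Ω_n` such that `π a = b` implies
`π (-a) = -b`, as a subgroup of the group of all permutations of `Ω_n`. -/
def Hyperoctahedral (n : ℕ) : Subgroup (Equiv.Perm (SignedSet n)) where
  carrier := {π | ∀ a : SignedSet n, π (-a) = -π a}
  one_mem' := fun _ => rfl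
  mul_mem' := by
    intro π σ hπ hσ a
    show π (σ (-a)) = -π (σ a)
    rw [hσ a, hπ (σ a)]
  inv_mem' := by
    intro π hπ a
    show π.symm (-a) = -π.symm a
    rw [Equiv.symm_apply_eq, hπ (π.symm a), Equiv.apply_symm_apply]

/-- The strict `r`-order `-1 <_r -2 <_r ⋯ <_r 0 <_r 1 <_r 2 <_r ⋯` on the integers. -/
def RLt (a b : ℤ) : Prop :=
  (a < 0 ∧ b < 0 ∧ b < a) ∨ (a < 0 ∧ 0 ≤ b) ∨ (0 ≤ a ∧ a < b)

instance RLt.instDecidable (a b : ℤ) : Decidable (RLt a b) := by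
  unfold RLt; infer_instance

/-- `π_i = π(i)` for `0 ≤ i ≤ n`; in particular `π_0 = π(0)`. -/
def Hyperoctahedral.entry {n : ℕ} (π : Hyperoctahedral n) (i : ℕ) (hi : i ≤ n) : ℤ :=
  (π.1 (SignedSet.ofNat i hi)).1

/-- The set of `i ∈ {0, …, n - 1}` with `π_i >_r π_{i+1}`. -/
def Hyperoctahedral.rDescents {n : ℕ} (π : Hyperoctahedral n) : Finset (Fin n) :=
  Finset.univ.filter fun i =>
    RLt (entry π (i.1 + 1) (Nat.succ_le_of_lt i.2)) (entry π i.1 i.2.le)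

/-- The number of descents of `π` under the `r`-order. -/
def Hyperoctahedral.rDes {n : ℕ} (π : Hyperoctahedral n) : ℕ := (rDescents π).card

/-- The signed involutions of length `n` with exactly `k` descents under the `r`-order. -/
def signedInvolutions (n : ℕ) (k : ℤ) : Set (Hyperoctahedral n) :=
  {π | π⁻¹ = π ∧ (Hyperoctahedral.rDes π : ℤ) = k}

/-- The number of signed involutions of length `n` with exactly `k` descents
under the `r`-order. -/
noncomputable def signedInvolutionCount (n : ℕ) (k : ℤ) : ℕ := (signedInvolutions n k).ncard

/-!
For `m ≥ 0` the sum `∑ k, I_{n,k} * (n + m - k).choose n` counts the pairs of a signed involution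
`π` and a word with letters in `{0, …, 2 * m}` compatible with `π`: the letters rise weakly, their
halves, rounded up, jump at each descent of `π`, and their parities record the signs of `π`, so that
a `π` with `k` descents has `(n + m - k).choose n` compatible words. By standardization such pairs
correspond to the multisets of size `n` of pairs `(a, b)` of letters of equal parity that are
invariant under exchanging `a` and `b`.

Let `W_n` be the number of these multisets. There are `2 * m ^ 2 + 2 * m + 1` pairs of letters of
equal parity, of which `2 * m + 1` are fixed by the exchange. Marking an element of a multiset and
removing its orbit under the exchange gives
`(n + 2) * W_{n+2} = (2 * m + 1) * W_{n+1} + (n + 2 * m ^ 2 + 2 * m + 1) * W_n`.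

Multiplication of `∑ k, a_k * (n + m - k).choose n` by a linear function of `m` yields a sum of the
same shape with `n + 1` in place of `n`, whose coefficients are combinations of `a_k` and
`a_{k-1}`. Since the sums determine their coefficients, the recurrence for `W_n` becomes the one for
`I_{n,k}`.
-/

section InvariantMultisets

variable {α : Type*} [DecidableEq α] {τ : α → α} {s : Finset α} {n : ℕ} {M : Multiset α} {p : α}

/-- The multisets of size `n` with elements in `s` that are invariant under `τ`. For
`τ = Prod.swap` these are the symmetric matrices of nonnegative integers supported in `s` with
entries summing to `n`, the multiplicity of `(a, b)` being the `(a, b)` entry. -/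
def invariantMultisets (τ : α → α) (s : Finset α) (n : ℕ) : Finset (Multiset α) :=
  {M ∈ (s.sym n).image (↑) | M.map τ = M}

theorem mem_invariantMultisets :
    M ∈ invariantMultisets τ s n ↔ M.card = n ∧ (∀ p ∈ M, p ∈ s) ∧ M.map τ = M := by
  rw [invariantMultisets, Finset.mem_filter, Finset.mem_image, ← and_assoc]
  refine and_congr_left' ⟨?_, fun h => ⟨⟨M, h.1⟩, Finset.mem_sym_iff.2 h.2, rfl⟩⟩
  rintro ⟨M, hM, rfl⟩
  exact ⟨M.2, Finset.mem_sym_iff.1 hM⟩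

theorem sum_sum_count_invariantMultisets :
    ∑ p ∈ s, ∑ M ∈ invariantMultisets τ s n, M.count p =
      n * (invariantMultisets τ s n).card := by
  have hcount : ∀ M ∈ invariantMultisets τ s n, ∑ p ∈ s, M.count p = n := fun M hM => by
    obtain ⟨hcard, hmem, -⟩ := mem_invariantMultisets.1 hM
    rw [Multiset.sum_count_eq_card hmem, hcard]
  rw [Finset.sum_comm, Finset.sum_congr rfl hcount, Finset.sum_const, smul_eq_mul, mul_comm]

theorem map_orbit_val (hτ : Function.Involutive τ) (p : α) :
    ({p, τ p} : Finset α).val.map τ = ({p, τ p} : Finset α).val := by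
  rw [← Finset.image_val_of_injOn hτ.injective.injOn, Finset.image_insert,
    Finset.image_singleton, hτ p, Finset.pair_comm]

theorem add_orbit_mem_invariantMultisets (hτ : Function.Involutive τ) (hs : ∀ p ∈ s, τ p ∈ s)
    (hp : p ∈ s) :
    M + ({p, τ p} : Finset α).val ∈ invariantMultisets τ s (n + ({p, τ p} : Finset α).card) ↔
      M ∈ invariantMultisets τ s n := by
  have horbit : ∀ q ∈ ({p, τ p} : Finset α).val, q ∈ s := by
    simp [hp, hs p hp]
  simp only [mem_invariantMultisets, Multiset.card_add, Finset.card_val, add_left_inj,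
    Multiset.mem_add, Multiset.map_add, map_orbit_val hτ p, or_imp, forall_and]
  rw [and_iff_left horbit]

theorem orbit_val_le (hM : M.map τ = M) (hp : p ∈ M) : ({p, τ p} : Finset α).val ≤ M := by
  rw [Finset.val_le_iff_val_subset]
  intro q hq
  rw [Finset.mem_val, Finset.mem_insert, Finset.mem_singleton] at hq
  rcases hq with rfl | rfl
  · exact hp
  · rw [← hM]
    exact Multiset.mem_map_of_mem τ hp

/-- Removing one copy of the orbit of `p` is a bijection from the invariant multisets containing
`p` to all invariant multisets of the smaller size. -/
theorem sum_count_invariantMultisets (hτ : Function.Involutive τ) (hs : ∀ p ∈ s, τ p ∈ s)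
    (hp : p ∈ s) :
    ∑ M ∈ invariantMultisets τ s (n + ({p, τ p} : Finset α).card), M.count p =
      ∑ M ∈ invariantMultisets τ s n, (M.count p + 1) := by
  have hcount : ({p, τ p} : Finset α).val.count p = 1 :=
    Multiset.count_eq_one_of_mem (Finset.nodup _) (Finset.mem_def.1 (Finset.mem_insert_self _ _))
  rw [← Finset.sum_filter_ne_zero]
  refine (Finset.sum_bij (fun M _ => M + ({p, τ p} : Finset α).val) ?_
    (fun _ _ _ _ h => add_right_cancel h) ?_ ?_).symm
  · intro M hM
    rw [Finset.mem_filter, add_orbit_mem_invariantMultisets hτ hs hp, Multiset.count_add, hcount]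
    exact ⟨hM, Nat.succ_ne_zero _⟩
  · intro M hM
    obtain ⟨hM, hpM⟩ := Finset.mem_filter.1 hM
    have hle := orbit_val_le (mem_invariantMultisets.1 hM).2.2 (Multiset.count_ne_zero.1 hpM)
    have hadd := tsub_add_cancel_of_le hle
    exact ⟨_, (add_orbit_mem_invariantMultisets hτ hs hp).1 (hadd.symm ▸ hM), hadd⟩
  · intro M _
    rw [Multiset.count_add, hcount]

theorem card_invariantMultisets_zero : (invariantMultisets τ s 0).card = 1 := by
  rw [Finset.card_eq_one]
  refine ⟨0, Finset.ext fun M => ?_⟩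
  rw [mem_invariantMultisets, Multiset.card_eq_zero, Finset.mem_singleton]
  exact and_iff_left_of_imp fun h => by simp [h]

theorem card_invariantMultisets_one :
    (invariantMultisets τ s 1).card = {p ∈ s | τ p = p}.card := by
  symm
  refine Finset.card_bij (fun p _ => {p}) ?_ (fun _ _ _ _ h => Multiset.singleton_inj.1 h) ?_
  · intro p hp
    simpa [mem_invariantMultisets] using hp
  · intro M hM
    obtain ⟨hcard, hmem, hmap⟩ := mem_invariantMultisets.1 hM
    obtain ⟨p, rfl⟩ := Multiset.card_eq_one.1 hcard
    exact ⟨p, by simpa using And.intro hmem hmap, rfl⟩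

/-- Counting pairs of an invariant multiset of size `n + 2` and one of its elements `p`, the
fixed points of `τ` contribute the additional term at `n + 1`. -/
theorem card_invariantMultisets_add_two (hτ : Function.Involutive τ) (hs : ∀ p ∈ s, τ p ∈ s) :
    (n + 2) * (invariantMultisets τ s (n + 2)).card =
      {p ∈ s | τ p = p}.card * (invariantMultisets τ s (n + 1)).card +
        (n + s.card) * (invariantMultisets τ s n).card := by
  have hcount : ∀ p ∈ s, ∑ M ∈ invariantMultisets τ s (n + 2), M.count p =
      (∑ M ∈ invariantMultisets τ s n, M.count p + (invariantMultisets τ s n).card) +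
        if τ p = p then (invariantMultisets τ s (n + 1)).card else 0 := by
    intro p hp
    have hremove := fun n => sum_count_invariantMultisets (n := n) hτ hs hp
    simp only [Finset.sum_add_distrib, Finset.sum_const, smul_eq_mul, mul_one] at hremove
    split_ifs with hfix
    · simp only [hfix, Finset.pair_eq_singleton, Finset.card_singleton] at hremove
      rw [hremove, hremove]
    · rw [Finset.card_pair (Ne.symm hfix)] at hremove
      rw [hremove, add_zero]
  rw [← sum_sum_count_invariantMultisets, Finset.sum_congr rfl hcount, Finset.sum_add_distrib,
    Finset.sum_add_distrib, sum_sum_count_invariantMultisets, ← Finset.sum_filter]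
  simp only [Finset.sum_const, smul_eq_mul]
  ring

end InvariantMultisets

section MonotoneWords

variable {α : Type*} [LinearOrder α] {n : ℕ}

theorem eq_of_monotone_of_map_univ_eq {f g : Fin n → α} (hf : Monotone f) (hg : Monotone g)
    (h : Finset.univ.val.map f = Finset.univ.val.map g) : f = g := by
  rw [Fin.univ_val_map, Fin.univ_val_map, Multiset.coe_eq_coe] at h
  exact List.ofFn_injective (h.eq_of_sortedLE hf.sortedLE_ofFn hg.sortedLE_ofFn)

theorem exists_monotone_map_univ_eq {M : Multiset α} (hM : M.card = n) :
    ∃ f : Fin n → α, Monotone f ∧ Finset.univ.val.map f = M := by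
  have hlength : (M.sort (· ≤ ·)).length = n := (Multiset.length_sort _).trans hM
  subst hlength
  refine ⟨(M.sort (· ≤ ·)).get, List.sortedLE_iff_monotone_get.1 ?_, ?_⟩
  · exact (Multiset.pairwise_sort M (· ≤ ·)).sortedLE
  · rw [Fin.univ_val_map, List.ofFn_get, Multiset.sort_eq]

theorem ncard_monotone_fin (n : ℕ) (α : Type*) [LinearOrder α] [Fintype α] :
    {f : Fin n → α | Monotone f}.ncard = (Fintype.card α).multichoose n := by
  rw [← Sym.card_sym_eq_multichoose, ← Nat.card_eq_fintype_card, ← Set.ncard_univ]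
  refine Set.ncard_congr (fun f _ => ⟨Finset.univ.val.map f, by simp⟩) (fun _ _ => trivial) ?_ ?_
  · intro f g hf hg h
    exact eq_of_monotone_of_map_univ_eq hf hg (congrArg Subtype.val h)
  · intro M _
    obtain ⟨f, hf, hfM⟩ := exists_monotone_map_univ_eq M.2
    exact ⟨f, hf, Subtype.ext hfM⟩

end MonotoneWords

section Standardization

variable {C D : Type*} {n : ℕ}

/-- The multiset of columns of the two-line array with top row `c` and bottom row `d ∘ σ`. -/
def columns (c : Fin n → C) (d : Fin n → D) (σ : Equiv.Perm (Fin n)) : Multiset (C × D) :=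
  Finset.univ.val.map fun i => (c i, d (σ i))

theorem map_swap_columns (c : Fin n → C) (d : Fin n → D) (σ : Equiv.Perm (Fin n)) :
    (columns c d σ).map Prod.swap = columns d c σ⁻¹ := by
  conv_rhs => rw [columns, ← Multiset.map_univ_val_equiv σ, Multiset.map_map]
  rw [columns, Multiset.map_map]
  simp only [Function.comp_def, Prod.swap_prod_mk, Equiv.Perm.coe_inv, Equiv.symm_apply_apply]

theorem forall_mem_columns_iff {c : Fin n → C} {d : Fin n → D} {σ : Equiv.Perm (Fin n)}
    {P : C × D → Prop} : (∀ p ∈ columns c d σ, P p) ↔ ∀ i, P (c i, d (σ i)) := by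
  simp [columns]

variable [LinearOrder C] [LinearOrder D]

/-- The two-line array with columns `(c i, d (σ i))` is sorted lexicographically, `d` is its
sorted bottom row and `σ` is the standardization of its bottom row, equal letters being numbered
from left to right. -/
structure IsStandardized (c : Fin n → C) (d : Fin n → D) (σ : Equiv.Perm (Fin n)) : Prop where
  strictMono_top : StrictMono fun i => toLex (c i, σ i)
  strictMono_bottom : StrictMono fun i => toLex (d i, σ⁻¹ i)

namespace IsStandardized

variable {c c' : Fin n → C} {d d' : Fin n → D} {σ σ' : Equiv.Perm (Fin n)}

theorem symm (h : IsStandardized c d σ) : IsStandardized d c σ⁻¹ :=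
  ⟨h.strictMono_bottom, by simpa only [inv_inv] using h.strictMono_top⟩

theorem monotone_top (h : IsStandardized c d σ) : Monotone c :=
  Prod.Lex.monotone_fst_ofLex.comp h.strictMono_top.monotone

theorem monotone_columns (h : IsStandardized c d σ) :
    Monotone fun i => toLex (c i, d (σ i)) := fun i j hij => by
  obtain ⟨hc, hσ⟩ := Prod.Lex.toLex_le_toLex'.1 (h.strictMono_top.monotone hij)
  exact Prod.Lex.toLex_le_toLex'.2 ⟨hc, fun heq => h.symm.monotone_top (hσ heq)⟩

theorem inv_eq_sort (h : IsStandardized c d σ) : σ⁻¹ = Tuple.sort (d ∘ σ) := by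
  rw [Tuple.eq_sort_iff]
  simp only [Function.comp_def, Equiv.Perm.coe_inv, Equiv.apply_symm_apply]
  exact ⟨h.symm.monotone_top, fun i j hij heq =>
    (Prod.Lex.toLex_lt_toLex'.1 (h.strictMono_bottom hij)).2 heq⟩

theorem eq_of_columns_eq (h : IsStandardized c d σ) (h' : IsStandardized c' d' σ')
    (heq : columns c d σ = columns c' d' σ') : c = c' ∧ d = d' ∧ σ = σ' := by
  have hword := eq_of_monotone_of_map_univ_eq h.monotone_columns h'.monotone_columns <| by
    simpa only [columns, Multiset.map_map, Function.comp_def] using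
      congrArg (Multiset.map toLex) heq
  have hcd : ∀ i, c i = c' i ∧ d (σ i) = d' (σ' i) := fun i =>
    Prod.ext_iff.1 (toLex.injective (congrFun hword i))
  have hσ : σ = σ' := inv_injective <| by
    rw [h.inv_eq_sort, h'.inv_eq_sort, show d ∘ σ = d' ∘ σ' from funext fun i => (hcd i).2]
  refine ⟨funext fun i => (hcd i).1, funext fun i => ?_, hσ⟩
  simpa [hσ] using (hcd (σ⁻¹ i)).2

end IsStandardized

theorem exists_isStandardized_columns_eq {M : Multiset (C × D)} (hM : M.card = n) :
    ∃ (c : Fin n → C) (d : Fin n → D) (σ : Equiv.Perm (Fin n)),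
      IsStandardized c d σ ∧ columns c d σ = M := by
  obtain ⟨w, hw, hwM⟩ := exists_monotone_map_univ_eq
    (M := M.map toLex) ((Multiset.card_map _ _).trans hM)
  set top : Fin n → C := fun i => (ofLex (w i)).1
  set bottom : Fin n → D := fun i => (ofLex (w i)).2
  set τ := Tuple.sort bottom with hτ
  obtain ⟨hmono, htie⟩ := Tuple.eq_sort_iff.1 hτ
  have hbottom : StrictMono fun i => toLex (bottom (τ i), τ i) := fun i j hij =>
    Prod.Lex.toLex_lt_toLex'.2 ⟨hmono hij.le, htie i j hij⟩
  refine ⟨top, bottom ∘ τ, τ⁻¹, ⟨fun i j hij => ?_, hbottom⟩, ?_⟩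
  · obtain ⟨hc, hd⟩ := Prod.Lex.toLex_le_toLex'.1 (hw hij.le)
    refine Prod.Lex.toLex_lt_toLex'.2 ⟨hc, fun heq => ?_⟩
    rw [← hbottom.lt_iff_lt]
    simpa using Prod.Lex.toLex_lt_toLex'.2 ⟨hd heq, fun _ => hij⟩
  · have hM' := congrArg (Multiset.map ofLex) hwM
    rw [Multiset.map_map, Multiset.map_map] at hM'
    simpa [columns, top, bottom, Function.comp_def] using hM'

/-- The pairs `(c, σ)` of a word `c` and an involution `σ` such that the columns `(c i, σ i)` are
lexicographically increasing and all the pairs `(c i, c (σ i))` are in `s`. -/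
def colouredInvolutions (s : Finset (C × C)) (n : ℕ) : Set ((Fin n → C) × Equiv.Perm (Fin n)) :=
  {p | p.2⁻¹ = p.2 ∧ (StrictMono fun i => toLex (p.1 i, p.2 i)) ∧ ∀ i, (p.1 i, p.1 (p.2 i)) ∈ s}

theorem ncard_colouredInvolutions (s : Finset (C × C)) (n : ℕ) :
    (colouredInvolutions s n).ncard = (invariantMultisets Prod.swap s n).card := by
  have hstd : ∀ {p}, p ∈ colouredInvolutions s n → IsStandardized p.1 p.1 p.2 := fun hp =>
    ⟨hp.2.1, by simpa only [hp.1] using hp.2.1⟩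
  rw [← Set.ncard_coe_finset]
  refine Set.ncard_congr (fun p _ => columns p.1 p.1 p.2) (fun p hp => ?_) (fun p q hp hq h => ?_)
    fun M hM => ?_
  · refine mem_invariantMultisets.2 ⟨by simp [columns], forall_mem_columns_iff.2 hp.2.2, ?_⟩
    rw [map_swap_columns, hp.1]
  · obtain ⟨hc, -, hσ⟩ := (hstd hp).eq_of_columns_eq (hstd hq) h
    exact Prod.ext hc hσ
  · obtain ⟨hcard, hmem, hswap⟩ := mem_invariantMultisets.1 hM
    obtain ⟨c, d, σ, h, rfl⟩ := exists_isStandardized_columns_eq hcard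
    obtain ⟨rfl, -, hσ⟩ := h.symm.eq_of_columns_eq h ((map_swap_columns c d σ).symm.trans hswap)
    exact ⟨(d, σ), ⟨hσ, h.strictMono_top, forall_mem_columns_iff.1 hmem⟩, rfl⟩

end Standardization

section GapChains

variable {n m : ℕ} {b : Fin n → ℕ} {f : Fin (n + 1) → ℕ}

/-- The chains `0 = f 0 ≤ f 1 ≤ ⋯ ≤ f n ≤ m` whose `i`-th step is at least `b i`. -/
def gapChains (b : Fin n → ℕ) (m : ℕ) : Set (Fin (n + 1) → ℕ) :=
  {f | f 0 = 0 ∧ (∀ i : Fin n, f i.castSucc + b i ≤ f i.succ) ∧ f (Fin.last n) ≤ m}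

theorem monotone_of_mem_gapChains (hf : f ∈ gapChains b m) : Monotone f :=
  Fin.monotone_iff_le_succ.2 fun i => le_trans (Nat.le_add_right _ _) (hf.2.1 i)

theorem partialSum_le_of_mem_gapChains (hf : f ∈ gapChains b m) (i : Fin (n + 1)) :
    Fin.partialSum b i ≤ f i := by
  induction i using Fin.induction with
  | zero => simp only [Fin.partialSum_zero, zero_le]
  | succ i ih => exact (Fin.partialSum_succ b i).trans_le (le_trans (by gcongr) (hf.2.1 i))

theorem monotone_sub_partialSum_of_mem_gapChains (hf : f ∈ gapChains b m) :
    Monotone fun i => f i - Fin.partialSum b i := by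
  refine Fin.monotone_iff_le_succ.2 fun i => ?_
  have := hf.2.1 i
  have := Fin.partialSum_succ b i
  omega

theorem partialSum_add_mem_gapChains {g : Fin n → Fin (m + 1)} (hg : Monotone g) :
    (fun i => Fin.partialSum b i + Fin.cons (α := fun _ => Fin (m + 1)) 0 g i) ∈
      gapChains b (Fin.partialSum b (Fin.last n) + m) := by
  have hcons : Monotone (Fin.cons (α := fun _ => Fin (m + 1)) 0 g) := by
    intro i j hij
    cases i using Fin.cases with
    | zero => simp only [Fin.cons_zero, Fin.zero_le]
    | succ i =>
      cases j using Fin.cases with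
      | zero => simp at hij
      | succ j => exact hg (Fin.succ_le_succ_iff.1 hij)
  refine ⟨by simp, fun i => ?_, Nat.add_le_add_left (Fin.is_le _) _⟩
  have hi : (Fin.cons (α := fun _ => Fin (m + 1)) 0 g i.castSucc).val ≤ _ :=
    hcons i.castSucc_lt_succ.le
  dsimp only
  rw [Fin.partialSum_succ, add_right_comm]
  gcongr

theorem ncard_gapChains (hb : ∑ i, b i ≤ n) (m : ℕ) :
    (gapChains b m).ncard = (n + m - ∑ i, b i).choose n := by
  have hsum : Fin.partialSum b (Fin.last n) = ∑ i, b i := by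
    rw [Fin.partialSum, Fin.val_last, List.take_of_length_le (List.length_ofFn).le,
      List.sum_ofFn]
  rcases lt_or_ge m (∑ i, b i) with hm | hm
  · have hempty : gapChains b m = ∅ := Set.eq_empty_of_forall_notMem fun f hf =>
      hm.not_ge (hsum ▸ (partialSum_le_of_mem_gapChains hf (Fin.last n)).trans hf.2.2)
    rw [hempty, Set.ncard_empty, Nat.choose_eq_zero_of_lt (by omega)]
  obtain ⟨k, rfl⟩ := Nat.exists_eq_add_of_le hm
  have hmonotone := ncard_monotone_fin n (Fin (k + 1))
  rw [Fintype.card_fin, Nat.multichoose_eq] at hmonotone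
  rw [show n + (∑ i, b i + k) - ∑ i, b i = k + 1 + n - 1 by omega, ← hmonotone]
  refine (Set.ncard_congr (fun g _ i => Fin.partialSum b i +
    Fin.cons (α := fun _ => Fin (k + 1)) 0 g i) (fun g hg => ?_) (fun g g' _ _ h => ?_)
      fun f hf => ?_).symm
  · exact hsum ▸ partialSum_add_mem_gapChains hg
  · funext i
    simpa [Fin.ext_iff] using congrFun h i.succ
  · have hle := partialSum_le_of_mem_gapChains hf
    have hsub := monotone_sub_partialSum_of_mem_gapChains hf
    have hlt : ∀ i, f i - Fin.partialSum b i < k + 1 := fun i => by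
      have : f (Fin.last n) ≤ _ := hf.2.2
      exact Nat.lt_succ_of_le ((hsub (Fin.le_last i)).trans (by dsimp only; omega))
    refine ⟨fun i => ⟨_, hlt i.succ⟩, fun i j hij => ?_, funext fun i => ?_⟩
    · exact hsub (Fin.succ_le_succ_iff.2 hij)
    · cases i using Fin.cases with
      | zero => simp [hf.1]
      | succ i => exact Nat.add_sub_cancel' (hle _)

end GapChains

section CompatibleWords

variable {n m : ℕ} {x : Fin (n + 1) → ℤ} {c : Fin n → ℕ}

/-- The words whose `i`-th letter is at most `2 * m`, is odd exactly where `x` is negative, and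
for which the columns of letters of `c` and absolute values of `x` are lexicographically
increasing. -/
def compatibleWords (x : Fin (n + 1) → ℤ) (m : ℕ) : Set (Fin n → ℕ) :=
  {c | (StrictMono fun i => toLex (c i, (x i.succ).natAbs)) ∧
    ∀ i, c i ≤ 2 * m ∧ (Odd (c i) ↔ x i.succ < 0)}

/-- The indicator function of the descents of `x` under the `r`-order. -/
def rDescentIndicator (x : Fin (n + 1) → ℤ) (i : Fin n) : ℕ :=
  if RLt (x i.succ) (x i.castSucc) then 1 else 0

/-- The letters `2 * v - 1` and `2 * v` both have half `v`, the first carrying the negative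
entries; since these precede the positive ones in the `r`-order, a constant half forces an
`r`-ascent. -/
theorem half_add_le_half_iff {a a' : ℤ} {c c' : ℕ} (habs : a.natAbs ≠ a'.natAbs)
    (hc : Odd c ↔ a < 0) (hc' : Odd c' ↔ a' < 0) :
    (c + 1) / 2 + (if RLt a' a then 1 else 0) ≤ (c' + 1) / 2 ↔
      toLex (c, a.natAbs) < toLex (c', a'.natAbs) := by
  rw [Prod.Lex.toLex_lt_toLex]
  rw [Nat.odd_iff] at hc hc'
  split_ifs with hlt <;> unfold RLt at hlt <;> dsimp only <;> omega

/-- The chain `0, ⌈c 0 / 2⌉, ⌈c 1 / 2⌉, …` that records a word up to the parity of its letters. -/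
def halfChain (c : Fin n → ℕ) (i : Fin (n + 1)) : ℕ := ((Fin.cons 0 c : Fin (n + 1) → ℕ) i + 1) / 2

theorem odd_cons_iff (hx₀ : x 0 = 0) (hc : ∀ i, Odd (c i) ↔ x i.succ < 0) (i : Fin (n + 1)) :
    Odd ((Fin.cons 0 c : Fin (n + 1) → ℕ) i) ↔ x i < 0 := by
  cases i using Fin.cases with
  | zero => simp [hx₀]
  | succ i => exact hc i

theorem strictMono_iff_halfChain (hx₀ : x 0 = 0) (hx : (Int.natAbs ∘ x).Injective)
    (hc : ∀ i, Odd (c i) ↔ x i.succ < 0) :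
    (StrictMono fun i => toLex (c i, (x i.succ).natAbs)) ↔
      ∀ i : Fin n, halfChain c i.castSucc + rDescentIndicator x i ≤ halfChain c i.succ := by
  have hcons : (StrictMono fun i => toLex (c i, (x i.succ).natAbs)) ↔
      StrictMono fun i => toLex ((Fin.cons 0 c : Fin (n + 1) → ℕ) i, (x i).natAbs) := by
    refine ⟨fun h i j hij => ?_, fun h => h.comp Fin.strictMono_succ⟩
    cases j using Fin.cases with
    | zero => simp at hij
    | succ j =>
      cases i using Fin.cases with
      | zero =>
        refine Prod.Lex.toLex_lt_toLex'.2 ⟨by simp, fun _ => ?_⟩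
        have : (x 0).natAbs ≠ (x j.succ).natAbs := hx.ne hij.ne
        grind
      | succ i => exact h (Fin.succ_lt_succ_iff.1 hij)
  rw [hcons, Fin.strictMono_iff_lt_succ]
  exact forall_congr' fun i => (half_add_le_half_iff (hx.ne i.castSucc_lt_succ.ne)
    (odd_cons_iff hx₀ hc _) (odd_cons_iff hx₀ hc _)).symm

theorem pos_of_mem_gapChains_of_neg {f : Fin (n + 1) → ℕ} (hx₀ : x 0 = 0)
    (hf : f ∈ gapChains (rDescentIndicator x) m) (i : Fin (n + 1)) (hi : x i < 0) : 0 < f i := by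
  induction i using Fin.induction with
  | zero => exact absurd hx₀ hi.ne
  | succ i ih =>
    have hstep := hf.2.1 i
    rcases lt_or_ge (x i.castSucc) 0 with hneg | hnonneg
    · exact (ih hneg).trans_le (le_of_add_le_left hstep)
    · have hdescent : RLt (x i.succ) (x i.castSucc) := Or.inr (Or.inl ⟨hi, hnonneg⟩)
      rw [rDescentIndicator, if_pos hdescent] at hstep
      exact Nat.lt_of_lt_of_le (Nat.succ_pos _) hstep

theorem ncard_compatibleWords (hx₀ : x 0 = 0) (hx : (Int.natAbs ∘ x).Injective) (m : ℕ) :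
    (compatibleWords x m).ncard = (n + m - ∑ i, rDescentIndicator x i).choose n := by
  have hsum : ∑ i, rDescentIndicator x i ≤ n := by
    simpa only [Finset.card_fin, smul_eq_mul, mul_one] using
      Finset.sum_le_card_nsmul Finset.univ (rDescentIndicator x) 1 fun i _ =>
        ite_le_one le_rfl zero_le_one
  rw [← ncard_gapChains hsum]
  refine Set.ncard_congr (fun c _ => halfChain c) (fun c hc => ?_) (fun c c' hc hc' h => ?_)
    fun f hf => ?_
  · refine ⟨by simp [halfChain], (strictMono_iff_halfChain hx₀ hx fun i => (hc.2 i).2).1 hc.1, ?_⟩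
    cases n with
    | zero => simp [halfChain]
    | succ n =>
      have := (hc.2 (Fin.last n)).1
      change (c (Fin.last n) + 1) / 2 ≤ m
      omega
  · funext i
    have hparity := (hc.2 i).2.trans (hc'.2 i).2.symm
    have hi : (c i + 1) / 2 = (c' i + 1) / 2 := congrFun h i.succ
    rw [Nat.odd_iff, Nat.odd_iff] at hparity
    omega
  · have hpos := pos_of_mem_gapChains_of_neg hx₀ hf
    set c : Fin n → ℕ := fun i => 2 * f i.succ - if x i.succ < 0 then 1 else 0
    have hodd : ∀ i, Odd (c i) ↔ x i.succ < 0 := fun i => by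
      have := hpos i.succ
      rw [Nat.odd_iff]
      grind
    have hhalf : halfChain c = f := funext fun i => by
      cases i using Fin.cases with
      | zero => simp [halfChain, hf.1]
      | succ i =>
        have := hpos i.succ
        change (c i + 1) / 2 = f i.succ
        grind
    refine ⟨c, ⟨(strictMono_iff_halfChain hx₀ hx hodd).2 (hhalf ▸ hf.2.1), fun i => ⟨?_, hodd i⟩⟩,
      hhalf⟩
    have := (monotone_of_mem_gapChains hf (Fin.le_last i.succ)).trans hf.2.2
    grind

end CompatibleWords

section SignedPermutations

variable {n m : ℕ}

theorem SignedSet.exists_natAbs_eq (a : SignedSet n) : ∃ j : Fin (n + 1), a.1.natAbs = j :=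
  ⟨⟨a.1.natAbs, by have := a.2; omega⟩, rfl⟩

namespace Hyperoctahedral

/-- The word `π_0 π_1 ⋯ π_n`. -/
def word (π : Hyperoctahedral n) (i : Fin (n + 1)) : ℤ := entry π i.1 i.is_le

theorem exists_natAbs_word_eq (π : Hyperoctahedral n) (i : Fin (n + 1)) :
    ∃ j : Fin (n + 1), (word π i).natAbs = j :=
  SignedSet.exists_natAbs_eq _

theorem val_apply_neg (π : Hyperoctahedral n) (a : SignedSet n) : (π.1 (-a)).1 = -(π.1 a).1 :=
  congrArg Subtype.val (π.2 a)

theorem word_zero (π : Hyperoctahedral n) : word π 0 = 0 :=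
  self_eq_neg.1 (val_apply_neg π (SignedSet.ofNat 0 n.zero_le))

theorem val_apply (π : Hyperoctahedral n) {a : SignedSet n} {j : Fin (n + 1)}
    (hj : a.1.natAbs = j) : (π.1 a).1 = a.1.sign * word π j := by
  rcases lt_trichotomy a.1 0 with hneg | hzero | hpos
  · obtain rfl : a = -SignedSet.ofNat j j.is_le := Subtype.ext (by
      change a.1 = -(j : ℤ)
      omega)
    rw [Int.sign_eq_neg_one_of_neg hneg, neg_one_mul, val_apply_neg]
    rfl
  · obtain rfl : a = SignedSet.ofNat 0 n.zero_le := Subtype.ext hzero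
    rw [hzero, Int.sign_zero, zero_mul]
    exact word_zero π
  · obtain rfl : a = SignedSet.ofNat j j.is_le := Subtype.ext (by
      change a.1 = (j : ℤ)
      omega)
    rw [Int.sign_eq_one_of_pos hpos, one_mul]
    rfl

theorem word_injective : Function.Injective (word : Hyperoctahedral n → Fin (n + 1) → ℤ) :=
  fun π ρ h => Subtype.ext <| Equiv.ext fun a => Subtype.ext <| by
    obtain ⟨j, hj⟩ := a.exists_natAbs_eq
    rw [val_apply π hj, val_apply ρ hj, h]

theorem natAbs_comp_word_injective (π : Hyperoctahedral n) : (Int.natAbs ∘ word π).Injective := by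
  intro i j hij
  rcases Int.natAbs_eq_natAbs_iff.1 hij with h | h
  · have hij : (i : ℤ) = j := congrArg Subtype.val (π.1.injective (Subtype.ext h))
    exact Fin.ext (Int.ofNat_injective hij)
  · have hneg : π.1 (SignedSet.ofNat i i.is_le) = π.1 (-SignedSet.ofNat j j.is_le) :=
      Subtype.ext (h.trans (val_apply_neg π _).symm)
    have hij : (i : ℤ) = -(j : ℤ) := congrArg Subtype.val (π.1.injective hneg)
    omega

theorem word_succ_ne_zero (π : Hyperoctahedral n) (i : Fin n) : word π i.succ ≠ 0 := fun h =>
  i.succ_ne_zero (natAbs_comp_word_injective π (congrArg Int.natAbs (h.trans (word_zero π).symm)))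

theorem exists_perm_natAbs_word_eq (π : Hyperoctahedral n) :
    ∃ σ : Equiv.Perm (Fin n), ∀ i, (word π i.succ).natAbs = σ i + 1 := by
  have hex : ∀ i : Fin n, ∃ j : Fin n, (word π i.succ).natAbs = j + 1 := fun i => by
    obtain ⟨j, hj⟩ := exists_natAbs_word_eq π i.succ
    obtain ⟨j, rfl⟩ := Fin.exists_succ_eq.2 (fun h : j = 0 => word_succ_ne_zero π i (by simp_all))
    exact ⟨j, hj⟩
  choose σ hσ using hex
  have hinj : Function.Injective σ := fun i j hij => Fin.succ_injective n <|
    natAbs_comp_word_injective π ((hσ i).trans (hij ▸ (hσ j).symm))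
  exact ⟨Equiv.ofBijective σ (Finite.injective_iff_bijective.1 hinj), hσ⟩

theorem sum_rDescentIndicator_word (π : Hyperoctahedral n) :
    ∑ i, rDescentIndicator (word π) i = rDes π :=
  (Finset.card_filter _ _).symm

end Hyperoctahedral

open Hyperoctahedral

/-- The words `π_0 π_1 ⋯ π_n` of signed involutions: `π` maps `|π_i|` to `i` up to the sign of
`π_i`. -/
def IsInvolutionWord (x : Fin (n + 1) → ℤ) : Prop :=
  ∀ i, ∃ j : Fin (n + 1), (x i).natAbs = j ∧ (x i).sign * x j = i

theorem isInvolutionWord_word {π : Hyperoctahedral n} (hπ : π⁻¹ = π) :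
    IsInvolutionWord (word π) := fun i => by
  obtain ⟨j, hj⟩ := exists_natAbs_word_eq π i
  refine ⟨j, hj, (val_apply π hj).symm.trans ?_⟩
  have happly : π.1 (π.1 (SignedSet.ofNat i i.is_le)) = SignedSet.ofNat i i.is_le :=
    congrArg (fun ρ : Hyperoctahedral n => ρ.1 _) (inv_eq_iff_mul_eq_one.1 hπ)
  exact congrArg Subtype.val happly

theorem IsInvolutionWord.apply_zero {x : Fin (n + 1) → ℤ} (hx : IsInvolutionWord x) : x 0 = 0 := by
  by_contra h
  obtain ⟨j, hj, hxj⟩ := hx 0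
  obtain ⟨l, -, hxl⟩ := hx j
  have hxj₀ : x j = 0 := (mul_eq_zero.1 hxj).resolve_left (mt Int.sign_eq_zero_iff_zero.1 h)
  rw [hxj₀, Int.sign_zero, zero_mul] at hxl
  omega

theorem exists_word_eq {x : Fin (n + 1) → ℤ} (hx : IsInvolutionWord x) :
    ∃ π : Hyperoctahedral n, π⁻¹ = π ∧ word π = x := by
  choose j hj using fun a : SignedSet n => a.exists_natAbs_eq
  let f : SignedSet n → SignedSet n := fun a => ⟨a.1.sign * x (j a), by
    obtain ⟨i, hi, -⟩ := hx (j a)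
    rcases Int.sign_trichotomy a.1 with h | h | h <;> rw [h] <;> omega⟩
  have hf : f.Involutive := fun a => Subtype.ext <| by
    obtain ⟨i, hi, hsign⟩ := hx (j a)
    have ha := Int.sign_mul_natAbs a.1
    rw [hj a, ← hsign] at ha
    change (a.1.sign * x (j a)).sign * x (j (f a)) = a.1
    rcases eq_or_ne a.1 0 with h | h
    · simp [h]
    · have hi' : j (f a) = i := Fin.ext <| by
        rw [← hj, ← hi, Int.natAbs_mul, Int.natAbs_sign_of_ne_zero h, one_mul]
      rw [hi', Int.sign_mul, Int.sign_sign, mul_assoc, ha]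
  have hneg : ∀ a, f (-a) = -f a := fun a => Subtype.ext <| by
    have hja : j (-a) = j a := Fin.ext <| by rw [← hj, ← hj]; exact Int.natAbs_neg _
    change (-a.1).sign * x (j (-a)) = -(a.1.sign * x (j a))
    rw [hja, Int.sign_neg, neg_mul]
  refine ⟨⟨hf.toPerm f, hneg⟩, Subtype.ext (hf.toPerm_symm), funext fun i => ?_⟩
  have hi : j (SignedSet.ofNat i i.is_le) = i := Fin.ext (hj _).symm
  change (i : ℤ).sign * x (j _) = x i
  rw [hi]
  cases i using Fin.cases with
  | zero => rw [hx.apply_zero, mul_zero]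
  | succ i => rw [Int.sign_eq_one_of_pos (Int.natCast_pos.2 i.succ_pos), one_mul]

/-- The word of the signed permutation with absolute values `σ`, negative where `c` is odd. -/
def signedWord (c : Fin n → ℕ) (σ : Equiv.Perm (Fin n)) : Fin (n + 1) → ℤ :=
  Fin.cons 0 fun i => (-1) ^ c i * ((σ i : ℤ) + 1)

theorem natAbs_signedWord_succ (c : Fin n → ℕ) (σ : Equiv.Perm (Fin n)) (i : Fin n) :
    (signedWord c σ i.succ).natAbs = σ i + 1 := by
  change ((-1) ^ c i * ((σ i : ℤ) + 1)).natAbs = _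
  rw [Int.natAbs_mul, Int.natAbs_pow, Int.natAbs_neg, Int.natAbs_one, one_pow, one_mul]
  omega

theorem sign_signedWord_succ (c : Fin n → ℕ) (σ : Equiv.Perm (Fin n)) (i : Fin n) :
    (signedWord c σ i.succ).sign = (-1) ^ c i := by
  change ((-1) ^ c i * ((σ i : ℤ) + 1)).sign = _
  rw [Int.sign_mul, Int.sign_eq_one_of_pos (a := (σ i : ℤ) + 1) (by omega), mul_one]
  rcases neg_one_pow_eq_or ℤ (c i) with h | h <;> rw [h] <;> rfl

theorem signedWord_succ_neg_iff (c : Fin n → ℕ) (σ : Equiv.Perm (Fin n)) (i : Fin n) :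
    signedWord c σ i.succ < 0 ↔ Odd (c i) := by
  rw [← Int.sign_eq_neg_one_iff_neg, sign_signedWord_succ,
    neg_one_pow_eq_neg_one_iff_odd (by norm_num)]

theorem eq_signedWord {π : Hyperoctahedral n} {c : Fin n → ℕ} {σ : Equiv.Perm (Fin n)}
    (hc : ∀ i, Odd (c i) ↔ word π i.succ < 0) (hσ : ∀ i, (word π i.succ).natAbs = σ i + 1) :
    word π = signedWord c σ := by
  funext i
  cases i using Fin.cases with
  | zero => exact word_zero π
  | succ i =>
    have habs := natAbs_signedWord_succ c σ i
    have hsign := signedWord_succ_neg_iff c σ i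
    grind

theorem isInvolutionWord_signedWord_iff {c : Fin n → ℕ} {σ : Equiv.Perm (Fin n)} :
    IsInvolutionWord (signedWord c σ) ↔ σ⁻¹ = σ ∧ ∀ i, Even (c i) ↔ Even (c (σ i)) := by
  have hsucc : ∀ i : Fin n, (∃ j : Fin (n + 1), (signedWord c σ i.succ).natAbs = j ∧
      (signedWord c σ i.succ).sign * signedWord c σ j = (i.succ : ℕ)) ↔
      σ (σ i) = i ∧ (Even (c i) ↔ Even (c (σ i))) := fun i => by
    have hj : ∀ j : Fin (n + 1), (signedWord c σ i.succ).natAbs = j ↔ (σ i).succ = j := fun j => by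
      rw [natAbs_signedWord_succ, Fin.ext_iff, Fin.val_succ]
    simp only [hj, exists_eq_left']
    change _ * ((-1) ^ c (σ i) * ((σ (σ i) : ℤ) + 1)) = ((i + 1 : ℕ) : ℤ) ↔ _
    rw [sign_signedWord_succ, ← mul_assoc, ← pow_add, ← Nat.even_add, Fin.ext_iff]
    rcases Nat.even_or_odd (c i + c (σ i)) with h | h
    · rw [h.neg_one_pow, and_iff_left h]
      omega
    · rw [h.neg_one_pow, iff_false_right (fun h' => Nat.not_even_iff_odd.2 h h'.2)]
      omega
  have hzero : ∃ j : Fin (n + 1), (signedWord c σ 0).natAbs = j ∧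
      (signedWord c σ 0).sign * signedWord c σ j = (0 : Fin (n + 1)).val := ⟨0, rfl, rfl⟩
  rw [IsInvolutionWord, Fin.forall_fin_succ, and_iff_right hzero, forall_congr' hsucc,
    forall_and, inv_eq_iff_mul_eq_one, Equiv.ext_iff]
  rfl

/-- The pairs of letters of equal parity at most `2 * m`. -/
def parityPairs (m : ℕ) : Finset (ℕ × ℕ) :=
  {p ∈ Finset.range (2 * m + 1) ×ˢ Finset.range (2 * m + 1) | Even p.1 ↔ Even p.2}

theorem mem_parityPairs {m : ℕ} {p : ℕ × ℕ} :
    p ∈ parityPairs m ↔ (p.1 ≤ 2 * m ∧ p.2 ≤ 2 * m) ∧ (Even p.1 ↔ Even p.2) := by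
  rw [parityPairs, Finset.mem_filter, Finset.mem_product, Finset.mem_range_succ_iff,
    Finset.mem_range_succ_iff]

theorem mem_colouredInvolutions_parityPairs {c : Fin n → ℕ} {σ : Equiv.Perm (Fin n)} :
    (c, σ) ∈ colouredInvolutions (parityPairs m) n ↔
      IsInvolutionWord (signedWord c σ) ∧ c ∈ compatibleWords (signedWord c σ) m := by
  have hlex : (StrictMono fun i => toLex (c i, (signedWord c σ i.succ).natAbs)) ↔
      StrictMono fun i => toLex (c i, σ i) := by
    simp only [natAbs_signedWord_succ, StrictMono, Prod.Lex.toLex_lt_toLex, add_lt_add_iff_right,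
      Fin.lt_def]
  simp only [colouredInvolutions, compatibleWords, Set.mem_ofPred_eq, mem_parityPairs,
    isInvolutionWord_signedWord_iff, signedWord_succ_neg_iff, hlex]
  constructor
  · rintro ⟨hσ, hmono, hc⟩
    exact ⟨⟨hσ, fun i => (hc i).2⟩, hmono, fun i => ⟨(hc i).1.1, trivial⟩⟩
  · rintro ⟨⟨hσ, heven⟩, hmono, hc⟩
    exact ⟨hσ, hmono, fun i => ⟨⟨(hc i).1, (hc (σ i)).1⟩, heven i⟩⟩

end SignedPermutations

section DescentGeneratingFunction

variable {n : ℕ}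

open Hyperoctahedral

instance SignedSet.instFinite (n : ℕ) : Finite (SignedSet n) :=
  (Set.finite_Icc (-(n : ℤ)) n).to_subtype

theorem finite_compatibleWords (x : Fin (n + 1) → ℤ) (m : ℕ) : (compatibleWords x m).Finite :=
  (Set.finite_Iic fun _ => 2 * m).subset fun _ hc i => (hc.2 i).1

theorem ncard_eq_sum_ncard_fibre {α β : Type*} [Fintype α] {s : Set (α × β)}
    (hs : ∀ a, {b | (a, b) ∈ s}.Finite) : s.ncard = ∑ a, {b | (a, b) ∈ s}.ncard := by
  have := fun a => (hs a).to_subtype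
  simp only [← Nat.card_coe_set_eq]
  rw [Nat.card_congr (Equiv.setProdEquivSigma s), Nat.card_sigma]

theorem ncard_colouredInvolutions_parityPairs (n m : ℕ) :
    (colouredInvolutions (parityPairs m) n).ncard =
      {q : Hyperoctahedral n × (Fin n → ℕ) |
        q.1⁻¹ = q.1 ∧ q.2 ∈ compatibleWords (word q.1) m}.ncard := by
  have hex : ∀ p ∈ colouredInvolutions (parityPairs m) n,
      ∃ π : Hyperoctahedral n, π⁻¹ = π ∧ word π = signedWord p.1 p.2 := fun p hp =>
    exists_word_eq (mem_colouredInvolutions_parityPairs.1 hp).1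
  choose π hπ hword using hex
  refine Set.ncard_congr (fun p hp => (π p hp, p.1)) (fun p hp => ⟨hπ p hp, ?_⟩)
    (fun p q hp hq h => ?_) ?_
  · exact (hword p hp).symm ▸ (mem_colouredInvolutions_parityPairs.1 hp).2
  · obtain ⟨hπ', hc⟩ := Prod.ext_iff.1 h
    have hsigned : signedWord p.1 p.2 = signedWord q.1 q.2 := by
      rw [← hword p hp, ← hword q hq, show π p hp = π q hq from hπ']
    refine Prod.ext hc (Equiv.ext fun i => Fin.ext ?_)
    simpa only [natAbs_signedWord_succ, add_left_inj] using
      congrArg (fun x => (x i.succ).natAbs) hsigned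
  · rintro ⟨ρ, c⟩ ⟨hρ, hc⟩
    obtain ⟨σ, hσ⟩ := exists_perm_natAbs_word_eq ρ
    have hρword := eq_signedWord (fun i => (hc.2 i).2) hσ
    have hmem : (c, σ) ∈ colouredInvolutions (parityPairs m) n :=
      mem_colouredInvolutions_parityPairs.2 (hρword ▸ ⟨isInvolutionWord_word hρ, hc⟩)
    exact ⟨(c, σ), hmem, Prod.ext (word_injective ((hword _ hmem).trans hρword.symm)) rfl⟩

theorem sum_choose_sub_rDes [Fintype (Hyperoctahedral n)] [DecidableEq (Hyperoctahedral n)]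
    (m : ℕ) :
    ∑ π : Hyperoctahedral n with π⁻¹ = π, (n + m - rDes π).choose n =
      (invariantMultisets Prod.swap (parityPairs m) n).card := by
  rw [← ncard_colouredInvolutions, ncard_colouredInvolutions_parityPairs,
    ncard_eq_sum_ncard_fibre fun π => (finite_compatibleWords (word π) m).subset fun c hc => hc.2,
    Finset.sum_filter]
  refine Finset.sum_congr rfl fun π _ => ?_
  split_ifs with hπ
  · simp only [Set.mem_ofPred_eq, hπ, true_and, Set.ofPred_mem_eq]
    rw [ncard_compatibleWords (word_zero π) (natAbs_comp_word_injective π),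
      sum_rDescentIndicator_word]
  · simp [hπ]

theorem sum_signedInvolutionCount_mul_choose (n m : ℕ) :
    ∑ k ∈ Finset.range (m + 1), signedInvolutionCount n k * (n + m - k).choose n =
      (invariantMultisets Prod.swap (parityPairs m) n).card := by
  classical
  have := Fintype.ofFinite (Hyperoctahedral n)
  have hcount : ∀ k : ℕ, signedInvolutionCount n k =
      {π ∈ ({π | π⁻¹ = π} : Finset (Hyperoctahedral n)) | rDes π = k}.card := fun k => by
    rw [signedInvolutionCount, signedInvolutions, ← Set.ncard_coe_finset]
    simp
  have hzero : ∀ π : Hyperoctahedral n, (n + m - rDes π).choose n ≠ 0 →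
      rDes π ∈ Finset.range (m + 1) := fun π hπ => by
    have hle := Nat.choose_ne_zero_iff.1 hπ
    have hrDes : rDes π ≤ n := (Finset.card_le_univ _).trans (Fintype.card_fin n).le
    rw [Finset.mem_range]
    omega
  rw [← sum_choose_sub_rDes, ← Finset.sum_filter_of_ne fun π _ => hzero π,
    ← Finset.sum_fiberwise_of_maps_to' (t := Finset.range (m + 1)) (g := rDes)
      (f := fun k => (n + m - k).choose n) fun π hπ => (Finset.mem_filter.1 hπ).2]
  refine Finset.sum_congr rfl fun k hk => ?_
  rw [Finset.sum_const, smul_eq_mul, hcount, Finset.filter_filter (fun π => rDes π ∈ _)]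
  congr 2
  refine Finset.filter_congr fun π _ => ?_
  exact (and_iff_right_of_imp fun h => h ▸ hk).symm

end DescentGeneratingFunction

section ParityPairs

theorem card_filter_even_range (m : ℕ) :
    {a ∈ Finset.range (2 * m + 1) | Even a}.card = m + 1 := by
  induction m with
  | zero => rfl
  | succ m ih =>
    rw [show 2 * (m + 1) + 1 = 2 * m + 1 + 1 + 1 by ring, Finset.range_add_one,
      Finset.filter_insert, if_pos (by grind), Finset.card_insert_of_notMem (by simp),
      Finset.range_add_one, Finset.filter_insert, if_neg (by grind), ih]

theorem card_parityPairs (m : ℕ) : (parityPairs m).card = 2 * m ^ 2 + 2 * m + 1 := by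
  have heven := card_filter_even_range m
  have hodd : {a ∈ Finset.range (2 * m + 1) | ¬Even a}.card = m := by
    have := Finset.card_filter_add_card_filter_not (s := Finset.range (2 * m + 1)) Even
    rw [Finset.card_range, heven] at this
    omega
  have hunion : parityPairs m =
      {a ∈ Finset.range (2 * m + 1) | Even a} ×ˢ {a ∈ Finset.range (2 * m + 1) | Even a} ∪
      {a ∈ Finset.range (2 * m + 1) | ¬Even a} ×ˢ {a ∈ Finset.range (2 * m + 1) | ¬Even a} := by
    ext p
    simp only [parityPairs, Finset.mem_filter, Finset.mem_product, Finset.mem_union]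
    tauto
  rw [hunion, Finset.card_union_of_disjoint, Finset.card_product, Finset.card_product, heven, hodd]
  · ring
  · exact Finset.disjoint_product.2 (Or.inl (Finset.disjoint_filter_filter_not _ _ _))

theorem card_filter_swap_eq_parityPairs (m : ℕ) :
    {p ∈ parityPairs m | p.swap = p}.card = 2 * m + 1 := by
  rw [← Finset.card_range (2 * m + 1)]
  refine (Finset.card_bij (fun a _ => (a, a)) (fun a ha => ?_)
    (fun _ _ _ _ h => congrArg Prod.fst h) fun p hp => ?_).symm
  · have := Finset.mem_range_succ_iff.1 ha
    simpa [mem_parityPairs]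
  · obtain ⟨hp, hswap⟩ := Finset.mem_filter.1 hp
    exact ⟨p.1, Finset.mem_range_succ_iff.2 (mem_parityPairs.1 hp).1.1,
      Prod.ext rfl (congrArg Prod.fst hswap).symm⟩

theorem card_invariantMultisets_parityPairs_one (m : ℕ) :
    (invariantMultisets Prod.swap (parityPairs m) 1).card = 2 * m + 1 := by
  rw [card_invariantMultisets_one, card_filter_swap_eq_parityPairs]

theorem card_invariantMultisets_parityPairs_add_two (n m : ℕ) :
    (n + 2) * (invariantMultisets Prod.swap (parityPairs m) (n + 2)).card =
      (2 * m + 1) * (invariantMultisets Prod.swap (parityPairs m) (n + 1)).card +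
        (n + (2 * m ^ 2 + 2 * m + 1)) * (invariantMultisets Prod.swap (parityPairs m) n).card := by
  have hswap : ∀ p ∈ parityPairs m, p.swap ∈ parityPairs m := fun p hp => by
    rw [mem_parityPairs] at hp ⊢
    exact ⟨hp.1.symm, hp.2.symm⟩
  rw [card_invariantMultisets_add_two Prod.swap_swap hswap, card_filter_swap_eq_parityPairs,
    card_parityPairs]

end ParityPairs

section BinomialTransform

/-- The values `∑ k ≤ m, a k * (n + m - k).choose n`, the coefficients of the power series
`(∑ a k x ^ k) / (1 - x) ^ (n + 1)`. The sequence is indexed by `ℤ` so that it can be shifted. -/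
def binomialTransform (n : ℕ) (a : ℤ → ℤ) (m : ℕ) : ℤ :=
  ∑ k ∈ Finset.range (m + 1), a k * (n + m - k).choose n

theorem binomialTransform_add (n : ℕ) (a b : ℤ → ℤ) (m : ℕ) :
    binomialTransform n (fun k => a k + b k) m =
      binomialTransform n a m + binomialTransform n b m := by
  simp only [binomialTransform, add_mul, Finset.sum_add_distrib]

theorem binomialTransform_const_mul (n : ℕ) (c : ℤ) (a : ℤ → ℤ) (m : ℕ) :
    binomialTransform n (fun k => c * a k) m = c * binomialTransform n a m := by
  simp only [binomialTransform, mul_assoc, Finset.mul_sum]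

theorem eq_of_binomialTransform_eq {n : ℕ} {a b : ℤ → ℤ}
    (h : binomialTransform n a = binomialTransform n b) (k : ℕ) : a k = b k := by
  induction k using Nat.strong_induction_on with
  | _ k ih =>
    have hlower : ∑ i ∈ Finset.range k, a i * ((n + k - i).choose n : ℤ) =
        ∑ i ∈ Finset.range k, b i * ((n + k - i).choose n : ℤ) :=
      Finset.sum_congr rfl fun i hi => by rw [ih i (Finset.mem_range.1 hi)]
    have hk := congrFun h k
    simp only [binomialTransform, Finset.sum_range_succ, hlower, Nat.add_sub_cancel,
      Nat.choose_self, Nat.cast_one, mul_one] at hk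
    exact add_left_cancel hk

theorem linear_mul_choose (u v k : ℤ) (n t : ℕ) :
    (u + v * (k + t)) * ((n + t).choose n : ℤ) =
      (u + v * k) * ((n + 1 + t).choose (n + 1) : ℤ) +
        (v * (n + 1 - k) - u) * ((n + t).choose (n + 1) : ℤ) := by
  have hpascal : ((n + 1 + t).choose (n + 1) : ℤ) =
      (n + t).choose n + (n + t).choose (n + 1) := by
    rw [show n + 1 + t = n + t + 1 by ring, Nat.choose_succ_succ, Nat.cast_add]
  have habsorb : ((n + t).choose (n + 1) : ℤ) * (n + 1) = (n + t).choose n * t := by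
    have := Nat.choose_succ_right_eq (n + t) n
    rw [Nat.add_sub_cancel_left] at this
    exact_mod_cast this
  rw [hpascal]
  linear_combination -v * habsorb

theorem linear_mul_binomialTransform {a : ℤ → ℤ} (ha : a (-1) = 0) (u v : ℤ) (n m : ℕ) :
    (u + v * m) * binomialTransform n a m =
      binomialTransform (n + 1)
        (fun k => (u + v * k) * a k + (v * (n + 2 - k) - u) * a (k - 1)) m := by
  have hshift : ∑ k ∈ Finset.range (m + 1),
      (v * (n + 2 - k) - u) * a (k - 1) * ((n + 1 + m - k).choose (n + 1) : ℤ) =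
      ∑ k ∈ Finset.range (m + 1),
        (v * (n + 1 - k) - u) * a k * ((n + m - k).choose (n + 1) : ℤ) := by
    rw [Finset.sum_range_succ', Finset.sum_range_succ _ m, Nat.add_sub_cancel,
      Nat.choose_succ_self]
    simp only [Nat.cast_zero, zero_sub, ha, mul_zero, zero_mul, add_zero]
    refine Finset.sum_congr rfl fun k _ => ?_
    rw [show n + 1 + m - (k + 1) = n + m - k by omega]
    push_cast
    rw [add_sub_cancel_right]
    ring
  rw [binomialTransform_add, binomialTransform, binomialTransform, binomialTransform, hshift,
    Finset.mul_sum, ← Finset.sum_add_distrib]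
  refine Finset.sum_congr rfl fun k hk => ?_
  obtain ⟨t, rfl⟩ := Nat.exists_eq_add_of_le (Finset.mem_range_succ_iff.1 hk)
  rw [show n + (k + t) - k = n + t by omega, show n + 1 + (k + t) - k = n + 1 + t by omega]
  push_cast
  linear_combination a k * linear_mul_choose u v k n t

theorem quadratic_mul_binomialTransform {a : ℤ → ℤ} (ha : ∀ k < 0, a k = 0) (c d : ℤ) (n m : ℕ) :
    (c + d * m * (m + 1)) * binomialTransform n a m =
      binomialTransform (n + 2)
        (fun k => (c + d * k * (k + 1)) * a k + (2 * d * k * (n + 2 - k) - 2 * c) * a (k - 1) +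
          (c + d * (n + 2 - k) * (n + 3 - k)) * a (k - 2)) m := by
  have hone := linear_mul_binomialTransform (ha (-1) (by norm_num)) 1 0 n m
  have hone_one := linear_mul_binomialTransform (a := fun k => (1 + 0 * k) * a k +
    (0 * (n + 2 - k) - 1) * a (k - 1)) (by simp [ha]) 1 0 (n + 1) m
  have hsucc := linear_mul_binomialTransform (ha (-1) (by norm_num)) 1 1 n m
  have hself_succ := linear_mul_binomialTransform (a := fun k => (1 + 1 * k) * a k +
    (1 * (n + 2 - k) - 1) * a (k - 1)) (by simp [ha]) 0 1 (n + 1) m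
  calc (c + d * m * (m + 1)) * binomialTransform n a m
      = c * ((1 + 0 * m) * ((1 + 0 * m) * binomialTransform n a m)) +
          d * ((0 + 1 * m) * ((1 + 1 * m) * binomialTransform n a m)) := by ring
    _ = _ := by
      rw [hone, hone_one, hsucc, hself_succ, ← binomialTransform_const_mul,
        ← binomialTransform_const_mul, ← binomialTransform_add]
      congr 1
      funext k
      rw [show k - 1 - 1 = k - 2 by ring]
      push_cast
      ring

end BinomialTransform

section Recurrence

theorem signedInvolutionCount_of_neg (n : ℕ) {k : ℤ} (hk : k < 0) :
    signedInvolutionCount n k = 0 := by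
  have hempty : signedInvolutions n k = ∅ :=
    Set.eq_empty_of_forall_notMem fun π hπ => (hπ.2 ▸ hk).not_ge (Int.natCast_nonneg _)
  rw [signedInvolutionCount, hempty, Set.ncard_empty]

theorem binomialTransform_signedInvolutionCount (n m : ℕ) :
    binomialTransform n (fun k => signedInvolutionCount n k) m =
      (invariantMultisets Prod.swap (parityPairs m) n).card := by
  rw [← sum_signedInvolutionCount_mul_choose, binomialTransform]
  push_cast
  rfl

theorem binomialTransform_signedInvolutionCount_add_two (n m : ℕ) :
    (n + 2) * binomialTransform (n + 2) (fun k => signedInvolutionCount (n + 2) k) m =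
      (1 + 2 * m) * binomialTransform (n + 1) (fun k => signedInvolutionCount (n + 1) k) m +
      (n + 1 + 2 * m * (m + 1)) * binomialTransform n (fun k => signedInvolutionCount n k) m := by
  have h := congrArg (Nat.cast : ℕ → ℤ) (card_invariantMultisets_parityPairs_add_two n m)
  simp only [binomialTransform_signedInvolutionCount]
  push_cast at h
  linear_combination h

theorem signedInvolutionCount_add_two (n k : ℕ) :
    (n + 2) * (signedInvolutionCount (n + 2) k : ℤ) =
      (2 * k + 1) * signedInvolutionCount (n + 1) k +
      (2 * (n + 2) - 2 * k + 1) * signedInvolutionCount (n + 1) (k - 1) +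
      (n + 1 + 2 * k * (k + 1)) * signedInvolutionCount n k +
      (2 * (n + 1) + 4 * (n + 1 - k) * (k - 1)) * signedInvolutionCount n (k - 1) +
      (n + 1 + 2 * (n + 2 - k) * (n + 3 - k)) * signedInvolutionCount n (k - 2) := by
  have hneg : ∀ l, ∀ k < 0, (signedInvolutionCount l k : ℤ) = 0 := fun l k hk => by
    rw [signedInvolutionCount_of_neg l hk, Nat.cast_zero]
  have htransform := funext fun m => binomialTransform_signedInvolutionCount_add_two n m
  simp only [linear_mul_binomialTransform
    (a := fun k => signedInvolutionCount (n + 1) k) (hneg (n + 1) (-1) (by norm_num)),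
    quadratic_mul_binomialTransform (hneg n), ← binomialTransform_const_mul,
    ← binomialTransform_add] at htransform
  have hk := eq_of_binomialTransform_eq htransform k
  push_cast at hk
  linear_combination hk

theorem sum_signedInvolutionCount_one (m : ℕ) :
    ∑ k ∈ Finset.range (m + 1), signedInvolutionCount 1 k * (1 + m - k).choose 1 = 2 * m + 1 := by
  rw [sum_signedInvolutionCount_mul_choose, card_invariantMultisets_parityPairs_one]

theorem two_mul_sum_signedInvolutionCount_two (m : ℕ) :
    2 * ∑ k ∈ Finset.range (m + 1), signedInvolutionCount 2 k * (2 + m - k).choose 2 =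
      (2 * m + 1) ^ 2 + (2 * m ^ 2 + 2 * m + 1) := by
  have h := card_invariantMultisets_parityPairs_add_two 0 m
  rw [zero_add, zero_add, card_invariantMultisets_parityPairs_one,
    card_invariantMultisets_zero] at h
  rw [sum_signedInvolutionCount_mul_choose]
  linarith

theorem signedInvolutionCount_one_zero : signedInvolutionCount 1 0 = 1 := by
  simpa using sum_signedInvolutionCount_one 0

theorem signedInvolutionCount_one_one : signedInvolutionCount 1 1 = 1 := by
  have h : 2 + signedInvolutionCount 1 1 = 3 := by
    simpa [Finset.sum_range_succ, signedInvolutionCount_one_zero] using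
      sum_signedInvolutionCount_one 1
  exact Nat.add_left_cancel h

theorem signedInvolutionCount_two_zero : signedInvolutionCount 2 0 = 1 := by
  simpa using two_mul_sum_signedInvolutionCount_two 0

theorem signedInvolutionCount_two_one : signedInvolutionCount 2 1 = 4 := by
  have h : 2 * (3 + signedInvolutionCount 2 1) = 14 := by
    simpa [Finset.sum_range_succ, Nat.choose, signedInvolutionCount_two_zero] using
      two_mul_sum_signedInvolutionCount_two 1
  omega

theorem signedInvolutionCount_two_two : signedInvolutionCount 2 2 = 1 := by
  have h : 2 * (6 + 4 * 3 + signedInvolutionCount 2 2) = 38 := by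
    simpa [Finset.sum_range_succ, Nat.choose, signedInvolutionCount_two_zero,
      signedInvolutionCount_two_one] using two_mul_sum_signedInvolutionCount_two 2
  omega

end Recurrence

theorem mainTheorem5 :
    (∀ (n : ℕ) (k : ℤ), 3 ≤ n → 0 ≤ k →
      (n : ℤ) * (signedInvolutionCount n k : ℤ) =
        (2 * k + 1) * (signedInvolutionCount (n - 1) k : ℤ)
        + (2 * (n : ℤ) - 2 * k + 1) * (signedInvolutionCount (n - 1) (k - 1) : ℤ)
        + ((n : ℤ) - 1 + 2 * k * (k + 1)) * (signedInvolutionCount (n - 2) k : ℤ)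
        + (2 * ((n : ℤ) - 1) + 4 * ((n : ℤ) - k - 1) * (k - 1))
            * (signedInvolutionCount (n - 2) (k - 1) : ℤ)
        + ((2 * (n : ℤ) - 3) * ((n : ℤ) - 1) + 2 * (k - 2) * (k - 2 * (n : ℤ) + 1))
            * (signedInvolutionCount (n - 2) (k - 2) : ℤ)) ∧
    signedInvolutionCount 1 0 = 1 ∧
    signedInvolutionCount 1 1 = 1 ∧
    signedInvolutionCount 2 0 = 1 ∧
    signedInvolutionCount 2 1 = 4 ∧
    signedInvolutionCount 2 2 = 1 ∧
    (∀ (n : ℕ) (k : ℤ), 1 ≤ n → k < 0 → signedInvolutionCount n k = 0) := by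
  refine ⟨fun n k hn hk => ?_, signedInvolutionCount_one_zero, signedInvolutionCount_one_one,
    signedInvolutionCount_two_zero, signedInvolutionCount_two_one, signedInvolutionCount_two_two,
    fun n k _ hk => signedInvolutionCount_of_neg n hk⟩
  obtain ⟨n, rfl⟩ := Nat.exists_eq_add_of_le' (show 2 ≤ n by omega)
  lift k to ℕ using hk
  rw [show n + 2 - 1 = n + 1 from rfl, Nat.add_sub_cancel]
  push_cast
  linear_combination signedInvolutionCount_add_two n k
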